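/- Let $F$ be a real quadratic field with ring of integers $\mathcal O_F$, regarded as a subfield of $\mathbf R$; let $x\mapsto x'$ be the nontrivial automorphism of $F$ (applied entrywise to matrices), $N$ the norm of $F/\mathbf Q$, and $\epsilon>1$ the fundamental unit of $F$. Let $l_1\ge l_2\ge 0$ be integers with $l_1\equiv l_2 \pmod 2$, and assume that $l_1$ is even if $N(\epsilon)=-1$. Let $\Gamma=\mathrm{PSL}(2,\mathcal O_F)$, let $\sigma,\mu\in\Gamma$ be the classes of $\begin{pmatrix}0&1\\-1&0\end{pmatrix}$ and $\begin{pmatrix}\epsilon&0\\0&\epsilon^{-1}\end{pmatrix}$, and let $P\subset\Gamma$ be the subgroup of the classes of the matrices $\begin{pmatrix}u&v\\0&u^{-1}\end{pmatrix}$, $u\in\mathcal O_F^\times$, $v\in\mathcal O_F$. For $l\ge 0$ let $\rho_l$ be the representation of $\mathrm{GL}(2,\mathbf C)$ on $\mathbf C^{l+1}$ with $\rho_l(g)\,{}^t(u^l,u^{l-1}v,\dots,v^l)={}^t(u_1^l,u_1^{l-1}v_1,\dots,v_1^l)$, where $\begin{pmatrix}u_1\\v_1\end{pmatrix}=g\begin{pmatrix}u\\v\end{pmatrix}$.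 Let $\Gamma$ act on $V=\mathbf C^{l_1+1}\otimes\mathbf C^{l_2+1}$ by $\gamma\mapsto\rho_{l_1}(\gamma)\otimes\rho_{l_2}(\gamma')$, and let $\{e_1,\dots,e_{l_1+1}\}$ and $\{e'_1,\dots,e'_{l_2+1}\}$ be the standard bases of the two factors. A normalized parabolic 2-cocycle is a 2-cocycle $f:\Gamma\times\Gamma\to V$ such that $f(1,\gamma)=f(\gamma,1)=0$ for all $\gamma\in\Gamma$ and $f(p\gamma_1,\gamma_2)=p\,f(\gamma_1,\gamma_2)$ for all $p\in P$, $\gamma_1,\gamma_2\in\Gamma$. A parabolic 2-coboundary is a map of the form $g(\gamma_1,\gamma_2)=\gamma_1b(\gamma_2)+b(\gamma_1)-b(\gamma_1\gamma_2)$ with $b:\Gamma\to V$, $b(1)=0$ and $b(p\gamma)=p\,b(\gamma)+b(p)$ for all $p\in P$, $\gamma\in\Gamma$. For $h:\Gamma\times\Gamma\to V$ and an integer $i$ with $(l_1-l_2)/2+1\le i\le(l_1+l_2)/2+1$, let $c_i(h)$ be the coefficient of $e_i\otimes e'_{i-(l_1-l_2)/2}$ in $h(\sigma,\mu)$; call such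 an $i$ admissible if $l_1\ne l_2$, or if $l_1=l_2$ and $i\ne 1,\,l_1+1$. Lemma 4.2. Let $f$ be a normalized parabolic 2-cocycle. (1) If $c_i(f)\neq0$ for some admissible $i$, then the cohomology class of $f$ in $H^2(\Gamma,V)$ is nontrivial. (2) For every parabolic 2-coboundary $g$ and every admissible $i$, $c_i(f+g)=c_i(f)$. -/

import Mathlib

open scoped TensorProduct NumberField MatrixGroups

noncomputable section

namespace HilbertCocycle

/-! ### The symmetric tensor representations -/

/-- The column vector `ᵗ(u ^ l, u ^ (l - 1) * v, …, v ^ l)` with `l + 1` components. -/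
def powVec (l : ℕ) (u v : ℂ) : Fin (l + 1) → ℂ :=
  fun i => u ^ (l - (i : ℕ)) * v ^ (i : ℕ)

/-- The matrix of `ρ_l(g)`. Its row `i` lists the coefficients of the form
`(a u + b v) ^ (l - i) * (c u + d v) ^ i` at the monomials `u ^ (l - j) * v ^ j`
(written with `v = 1`), where `g = !![a, b; c, d]`. -/
def symMatrix (l : ℕ) (g : Matrix (Fin 2) (Fin 2) ℂ) :
    Matrix (Fin (l + 1)) (Fin (l + 1)) ℂ :=
  Matrix.of fun i j =>
    ((Polynomial.C (g 0 0) * Polynomial.X + Polynomial.C (g 0 1)) ^ (l - (i : ℕ)) *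
      (Polynomial.C (g 1 0) * Polynomial.X + Polynomial.C (g 1 1)) ^ (i : ℕ)).coeff (l - (j : ℕ))

theorem eval_homogenize_sum (l : ℕ) (p : Polynomial ℂ) (u v : ℂ) :
    MvPolynomial.eval ![u, v] (p.homogenize l) =
      ∑ j : Fin (l + 1), p.coeff (l - (j : ℕ)) * (u ^ (l - (j : ℕ)) * v ^ (j : ℕ)) := by
  rw [Fin.sum_univ_eq_sum_range (fun j => p.coeff (l - j) * (u ^ (l - j) * v ^ j)) (l + 1)]
  rw [← Finset.sum_range_reflect]
  simp only [Polynomial.homogenize, Finset.Nat.sum_antidiagonal_eq_sum_range_succ_mk, map_sum]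
  refine Finset.sum_congr rfl fun k hk => ?_
  have hk' : k ≤ l := Nat.lt_succ_iff.mp (Finset.mem_range.mp hk)
  rw [MvPolynomial.eval_monomial, Finsupp.update_eq_add_single (by simp),
    Finsupp.prod_add_index', Finsupp.prod_single_index, Finsupp.prod_single_index]
  · have h1 : l - (l + 1 - 1 - k) = k := by omega
    have h2 : l + 1 - 1 - k = l - k := by omega
    rw [h1, h2]
    simp
  all_goals simp [pow_add]

/-- The defining property `ρ_l(g) [u; v] ^ l = (g [u; v]) ^ l` of `ρ_l`. -/
theorem symMatrix_mulVec_powVec (l : ℕ) (g : Matrix (Fin 2) (Fin 2) ℂ) (u v : ℂ) :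
    (symMatrix l g).mulVec (powVec l u v) =
      powVec l (g 0 0 * u + g 0 1 * v) (g 1 0 * u + g 1 1 * v) := by
  have hdeg : ∀ a b : ℂ, (Polynomial.C a * Polynomial.X + Polynomial.C b).natDegree ≤ 1 :=
    fun a b => Polynomial.natDegree_linear_le
  have hlin : ∀ a b : ℂ, MvPolynomial.eval ![u, v]
      ((Polynomial.C a * Polynomial.X + Polynomial.C b).homogenize 1) = a * u + b * v := by
    intro a b
    simp
  have hpow : ∀ (a b : ℂ) (n : ℕ), MvPolynomial.eval ![u, v]
      (((Polynomial.C a * Polynomial.X + Polynomial.C b) ^ n).homogenize n) =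
        (a * u + b * v) ^ n := by
    intro a b n
    have h := Polynomial.homogenize_finsetProd (s := Finset.range n)
      (p := fun _ => Polynomial.C a * Polynomial.X + Polynomial.C b) (n := fun _ => 1)
      (fun _ _ => hdeg a b)
    simp only [Finset.prod_const, Finset.card_range, Finset.sum_const, smul_eq_mul,
      mul_one] at h
    rw [h, map_pow, hlin]
  have hdegp : ∀ (a b : ℂ) (n : ℕ),
      ((Polynomial.C a * Polynomial.X + Polynomial.C b) ^ n).natDegree ≤ n := by
    intro a b n
    exact (Polynomial.natDegree_pow_le_of_le n (hdeg a b)).trans (by simp)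
  funext i
  have hi : l - (i : ℕ) + (i : ℕ) = l := Nat.sub_add_cancel (Nat.lt_succ_iff.mp i.2)
  have h := eval_homogenize_sum l
    ((Polynomial.C (g 0 0) * Polynomial.X + Polynomial.C (g 0 1)) ^ (l - (i : ℕ)) *
      (Polynomial.C (g 1 0) * Polynomial.X + Polynomial.C (g 1 1)) ^ (i : ℕ)) u v
  have h' := Polynomial.homogenize_mul _ _ (hdegp (g 0 0) (g 0 1) (l - (i : ℕ)))
    (hdegp (g 1 0) (g 1 1) (i : ℕ))
  rw [hi] at h'
  rw [h', map_mul, hpow, hpow] at h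
  simp only [Matrix.mulVec, dotProduct, symMatrix, Matrix.of_apply, powVec]
  exact h.symm

/-- A matrix is determined by its values on the vectors `[z; 1] ^ l`. -/
theorem eq_of_mulVec_powVec (l : ℕ) (A B : Matrix (Fin (l + 1)) (Fin (l + 1)) ℂ)
    (h : ∀ u v, A.mulVec (powVec l u v) = B.mulVec (powVec l u v)) : A = B := by
  set W : Matrix (Fin (l + 1)) (Fin (l + 1)) ℂ :=
    (Matrix.vandermonde fun i : Fin (l + 1) => ((i : ℕ) : ℂ)).transpose with hW
  have hdet : IsUnit W.det := by
    rw [hW, Matrix.det_transpose, isUnit_iff_ne_zero, Matrix.det_vandermonde_ne_zero_iff]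
    intro i j hij
    exact Fin.ext (Nat.cast_injective (R := ℂ) hij)
  have hAB : A * W = B * W := by
    ext i k
    have := congrFun (h 1 ((k : ℕ) : ℂ)) i
    simpa [Matrix.mulVec, dotProduct, Matrix.mul_apply, powVec, hW,
      Matrix.vandermonde_apply] using this
  have hW' : W * W⁻¹ = 1 := Matrix.mul_nonsing_inv W hdet
  calc A = A * W * W⁻¹ := by rw [Matrix.mul_assoc, hW', Matrix.mul_one]
    _ = B := by rw [hAB, Matrix.mul_assoc, hW', Matrix.mul_one]

/-- `ρ_l : M(2, ℂ) → M(l + 1, ℂ)`, whose restriction to `GL(2, ℂ)` is the symmetric tensor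
representation of degree `l`. -/
def symHom (l : ℕ) : Matrix (Fin 2) (Fin 2) ℂ →* Matrix (Fin (l + 1)) (Fin (l + 1)) ℂ where
  toFun := symMatrix l
  map_one' := eq_of_mulVec_powVec l _ _ fun u v => by
    rw [symMatrix_mulVec_powVec]; simp
  map_mul' g h := eq_of_mulVec_powVec l _ _ fun u v => by
    rw [← Matrix.mulVec_mulVec, symMatrix_mulVec_powVec, symMatrix_mulVec_powVec,
      symMatrix_mulVec_powVec]
    simp only [Matrix.mul_apply, Fin.sum_univ_two]
    congr 1 <;> ring

theorem symHom_scalar (l : ℕ) (r : ℂ) :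
    symHom l (Matrix.scalar (Fin 2) r) = r ^ l • (1 : Matrix (Fin (l + 1)) (Fin (l + 1)) ℂ) :=
  eq_of_mulVec_powVec l _ _ fun u v => by
    change (symMatrix l _).mulVec _ = _
    rw [symMatrix_mulVec_powVec, Matrix.smul_mulVec, Matrix.one_mulVec]
    funext i
    have hi : l - (i : ℕ) + (i : ℕ) = l := Nat.sub_add_cancel (Nat.lt_succ_iff.mp i.2)
    simp only [Matrix.scalar_apply, Matrix.diagonal_apply_eq, powVec, Pi.smul_apply, smul_eq_mul,
      ne_eq, Fin.zero_eq_one_iff, one_ne_zero, OfNat.ofNat_ne_one, not_false_eq_true,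
      Matrix.diagonal_apply_ne, zero_mul, add_zero, zero_add]
    rw [mul_pow, mul_pow]
    have hr : r ^ l = r ^ (l - (i : ℕ)) * r ^ (i : ℕ) := by rw [← pow_add, hi]
    rw [hr]
    ring

/-! ### The `Γ`-module `V` -/

section Module

variable {F : Type} [Field F]

/-- The map `𝓞 F → ℂ` induced by a real embedding of `F`. -/
def toComplex (τ : F →+* ℝ) : 𝓞 F →+* ℂ :=
  (Complex.ofRealHom.comp τ).comp (algebraMap (𝓞 F) F)

/-- The space `V = V₁ ⊗ V₂ = ℂ ^ (l₁ + 1) ⊗ ℂ ^ (l₂ + 1)`. -/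
abbrev V (l₁ l₂ : ℕ) : Type := (Fin (l₁ + 1) → ℂ) ⊗[ℂ] (Fin (l₂ + 1) → ℂ)

/-- `ρ_l` on `SL(2, 𝓞 F)` through a real embedding of `F`. -/
def symRep (τ : F →+* ℝ) (l : ℕ) : Representation ℂ SL(2, 𝓞 F) (Fin (l + 1) → ℂ) where
  toFun γ := Matrix.toLin' (symHom l (γ.1.map (toComplex τ)))
  map_one' := by simp; rfl
  map_mul' γ δ := by
    rw [Matrix.SpecialLinearGroup.coe_mul, Matrix.map_mul, map_mul, Matrix.toLin'_mul]
    rfl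

/-- `ρ = ρ_{l₁} ⊗ ρ_{l₂}` as a representation of `SL(2, 𝓞 F)`:
`γ` acts as `ρ_{l₁}(γ) ⊗ ρ_{l₂}(γ')`, where `γ` and its conjugate `γ'` are regarded as real
matrices through `τ₁` and `τ₂`. -/
def rhoSL (τ₁ τ₂ : F →+* ℝ) (l₁ l₂ : ℕ) : Representation ℂ SL(2, 𝓞 F) (V l₁ l₂) :=
  (symRep τ₁ l₁).tprod (symRep τ₂ l₂)

theorem rhoSL_center (τ₁ τ₂ : F →+* ℝ) {l₁ l₂ : ℕ} (hl : l₁ ≡ l₂ [MOD 2])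
    (γ : SL(2, 𝓞 F)) (hγ : γ ∈ Subgroup.center SL(2, 𝓞 F)) : rhoSL τ₁ τ₂ l₁ l₂ γ = 1 := by
  obtain ⟨r, hr, hγr⟩ := Matrix.SpecialLinearGroup.mem_center_iff.mp hγ
  have hsym : ∀ (τ : F →+* ℝ) (l : ℕ),
      symRep τ l γ = (toComplex τ r) ^ l • (LinearMap.id : (Fin (l + 1) → ℂ) →ₗ[ℂ] _) := by
    intro τ l
    change Matrix.toLin' (symHom l (γ.1.map (toComplex τ))) = _
    have h1 : γ.1.map (toComplex τ) = Matrix.scalar (Fin 2) (toComplex τ r) := by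
      rw [← hγr]
      ext i j
      by_cases hij : i = j
      · subst hij; simp
      · simp [hij]
    rw [h1, symHom_scalar, map_smul, Matrix.toLin'_one]
  rw [Fintype.card_fin, sq_eq_one_iff] at hr
  rw [rhoSL, Representation.tprod_apply, hsym, hsym, TensorProduct.map_smul_left,
    TensorProduct.map_smul_right, TensorProduct.map_id, smul_smul]
  have hc : toComplex τ₁ r ^ l₁ * toComplex τ₂ r ^ l₂ = 1 := by
    rcases hr with rfl | rfl
    · simp
    · rw [map_neg, map_neg, map_one, map_one, ← pow_add]
      refine Even.neg_one_pow ?_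
      have := hl
      unfold Nat.ModEq at this
      rw [Nat.even_iff]
      omega
  rw [hc, one_smul]
  rfl

/-- `V` as a representation of `Γ = PSL(2, 𝓞 F)`. -/
def rho (τ₁ τ₂ : F →+* ℝ) {l₁ l₂ : ℕ} (hl : l₁ ≡ l₂ [MOD 2]) :
    Representation ℂ PSL(2, 𝓞 F) (V l₁ l₂) :=
  QuotientGroup.lift (Subgroup.center SL(2, 𝓞 F)) (rhoSL τ₁ τ₂ l₁ l₂)
    (rhoSL_center τ₁ τ₂ hl)

/-- `V` as an object of the category of complex representations of `Γ = PSL(2, 𝓞 F)`. -/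
abbrev VRep (τ₁ τ₂ : F →+* ℝ) {l₁ l₂ : ℕ} (hl : l₁ ≡ l₂ [MOD 2]) : Rep ℂ PSL(2, 𝓞 F) :=
  Rep.of (rho τ₁ τ₂ hl)

/-- The coefficient of `e_i ⊗ e'_j` in `v`, where `e_1, …, e_{l₁ + 1}` and `e'_1, …, e'_{l₂ + 1}`
are the standard bases, numbered from `1`; it is `0` if an index is out of range. -/
def coeff {l₁ l₂ : ℕ} (v : V l₁ l₂) (i j : ℕ) : ℂ :=
  if h : (1 ≤ i ∧ i ≤ l₁ + 1) ∧ (1 ≤ j ∧ j ≤ l₂ + 1) then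
    ((Pi.basisFun ℂ (Fin (l₁ + 1))).tensorProduct (Pi.basisFun ℂ (Fin (l₂ + 1)))).repr v
      (⟨i - 1, by omega⟩, ⟨j - 1, by omega⟩)
  else 0

/-! ### Elements and subgroups of `Γ` -/

/-- `ε` is the fundamental unit with respect to the real embedding `τ`: it is greater than `1`,
and every unit is `± ε ^ n`. -/
def IsFundamentalUnit (τ : F →+* ℝ) (ε : (𝓞 F)ˣ) : Prop :=
  1 < τ (ε : 𝓞 F) ∧ ∀ u : (𝓞 F)ˣ, ∃ n : ℤ, u = ε ^ n ∨ u = -ε ^ n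

/-- The matrix `!![u, v; 0, u⁻¹]`. -/
def upper (u : (𝓞 F)ˣ) (v : 𝓞 F) : SL(2, 𝓞 F) :=
  ⟨!![(u : 𝓞 F), v; 0, ((u⁻¹ : (𝓞 F)ˣ) : 𝓞 F)], by simp [Matrix.det_fin_two]⟩

theorem upper_one : upper (1 : (𝓞 F)ˣ) 0 = 1 := by
  apply Subtype.ext
  rw [Matrix.SpecialLinearGroup.coe_one, Matrix.one_fin_two]
  simp only [upper, inv_one, Units.val_one]

theorem upper_mul (u u' : (𝓞 F)ˣ) (v v' : 𝓞 F) :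
    upper u v * upper u' v' = upper (u * u') (u * v' + v * ((u'⁻¹ : (𝓞 F)ˣ) : 𝓞 F)) := by
  apply Subtype.ext
  rw [Matrix.SpecialLinearGroup.coe_mul]
  simp only [upper, Matrix.mul_fin_two, mul_inv, Units.val_mul, mul_zero, zero_mul, add_zero,
    zero_add]

/-- The class in `Γ` of a matrix. -/
abbrev toPSL : SL(2, 𝓞 F) →* PSL(2, 𝓞 F) :=
  QuotientGroup.mk' (Subgroup.center SL(2, 𝓞 F))

variable (F) in
/-- The subgroup `P` of `Γ` of the classes of the matrices `!![u, v; 0, u⁻¹]`. -/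
def P : Subgroup PSL(2, 𝓞 F) where
  carrier := {p | ∃ (u : (𝓞 F)ˣ) (v : 𝓞 F), p = toPSL (upper u v)}
  one_mem' := ⟨1, 0, by rw [upper_one, map_one]⟩
  mul_mem' := by
    rintro _ _ ⟨u, v, rfl⟩ ⟨u', v', rfl⟩
    exact ⟨u * u', u * v' + v * ((u'⁻¹ : (𝓞 F)ˣ) : 𝓞 F), by rw [← map_mul, upper_mul]⟩
  inv_mem' := by
    rintro _ ⟨u, v, rfl⟩
    refine ⟨u⁻¹, -v, ?_⟩
    rw [← map_inv]
    refine congrArg toPSL (inv_eq_of_mul_eq_one_right ?_)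
    rw [upper_mul, ← upper_one]
    congr 1 <;> simp [mul_comm]

variable (F) in
/-- The class `σ` of `!![0, 1; -1, 0]` in `Γ`. -/
def sigma : PSL(2, 𝓞 F) :=
  toPSL ⟨!![0, 1; -1, 0], by simp [Matrix.det_fin_two]⟩

/-- The class `μ` of `!![ε, 0; 0, ε⁻¹]` in `Γ`. -/
def mu (ε : (𝓞 F)ˣ) : PSL(2, 𝓞 F) :=
  toPSL (upper ε 0)

/-! ### Parabolic cocycles -/

/-- The space `Z_P²(Γ, V)` of normalized parabolic `2`-cocycles: the `2`-cocycles with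
`f(1, γ) = f(γ, 1) = 0` and `f(pγ₁, γ₂) = p f(γ₁, γ₂)` for `p ∈ P`. -/
def parabolicCocycles (τ₁ τ₂ : F →+* ℝ) {l₁ l₂ : ℕ} (hl : l₁ ≡ l₂ [MOD 2]) :
    Submodule ℂ (groupCohomology.cocycles₂ (VRep τ₁ τ₂ hl)) where
  carrier := {f | (∀ γ, f (1, γ) = 0 ∧ f (γ, 1) = 0) ∧
    ∀ p ∈ P F, ∀ γ₁ γ₂, f (p * γ₁, γ₂) = rho τ₁ τ₂ hl p (f (γ₁, γ₂))}
  zero_mem' := by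
    refine ⟨fun γ => ⟨rfl, rfl⟩, fun p _ γ₁ γ₂ => ?_⟩
    exact (map_zero (rho τ₁ τ₂ hl p)).symm
  add_mem' := by
    rintro f g ⟨hf, hf'⟩ ⟨hg, hg'⟩
    refine ⟨fun γ => ⟨?_, ?_⟩, fun p hp γ₁ γ₂ => ?_⟩
    · change f (1, γ) + g (1, γ) = 0
      rw [(hf γ).1, (hg γ).1, add_zero]
    · change f (γ, 1) + g (γ, 1) = 0
      rw [(hf γ).2, (hg γ).2, add_zero]
    · change f (p * γ₁, γ₂) + g (p * γ₁, γ₂) = rho τ₁ τ₂ hl p (f (γ₁, γ₂) + g (γ₁, γ₂))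
      rw [hf' p hp, hg' p hp, map_add]
  smul_mem' := by
    rintro c f ⟨hf, hf'⟩
    refine ⟨fun γ => ⟨?_, ?_⟩, fun p hp γ₁ γ₂ => ?_⟩
    · change c • f (1, γ) = 0
      rw [(hf γ).1, smul_zero]
    · change c • f (γ, 1) = 0
      rw [(hf γ).2, smul_zero]
    · change c • f (p * γ₁, γ₂) = rho τ₁ τ₂ hl p (c • f (γ₁, γ₂))
      rw [hf' p hp, map_smul]

/-- `g` belongs to `B_P²(Γ, V)`, the space of parabolic `2`-coboundaries: `g = db` for a
`1`-cochain `b` with `b(1) = 0` and `b(pγ) = p b(γ) + b(p)` for `p ∈ P`. -/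
def IsParabolicCoboundary (τ₁ τ₂ : F →+* ℝ) {l₁ l₂ : ℕ} (hl : l₁ ≡ l₂ [MOD 2])
    (g : PSL(2, 𝓞 F) × PSL(2, 𝓞 F) → V l₁ l₂) : Prop :=
  ∃ b : PSL(2, 𝓞 F) → V l₁ l₂,
    (∀ γ₁ γ₂, g (γ₁, γ₂) = rho τ₁ τ₂ hl γ₁ (b γ₂) + b γ₁ - b (γ₁ * γ₂)) ∧
    b 1 = 0 ∧
    ∀ p ∈ P F, ∀ γ, b (p * γ) = rho τ₁ τ₂ hl p (b γ) + b p

end Module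

end HilbertCocycle

end

/-! ### Polynomial sums and interpolation -/

namespace HilbertCocycle

/-! Both parts reduce to one claim: if `b(pγ) = p b(γ) + b(p)` for all `p ∈ P`, then the admissible
coefficients of `db(σ, μ)` vanish. In part (1), any `b` with `f = db` has this property, because
`f(p, γ) = p f(1, γ) = 0`.

The relation `μσμ = σ` gives `b(σ) = μ b(σμ) + b(μ)`. The relevant vectors `e_i ⊗ e'_j` are those on
which `μ` acts trivially, the sign of `N(ε)` being absorbed by the parity assumption. So in these
coordinates `b(σ) - b(σμ)` equals `b(μ)`, and `σ b(μ)` contributes, up to sign, the coordinate of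
`b(μ)` at the reversed index. It remains to see that the weight-zero coordinates of `b(μ)` vanish,
except possibly the one at `e_1`; this is `IsCrossedOn.coord_mu_eq_zero`.

For that, write `u(x)` for the class of `!![1, x; 0, 1]`. Each coordinate of `b(u(nx))` is a
polynomial in `n`, whose linear coefficient `β(x)` is additive in `x`. Take the coordinate just
before the wanted one in the first factor, where `μ` acts by `ε²`. The linear terms of `μ u(x) =
u(ε² x) μ` under `b` give `ε² β(x) - β(ε² x) = a x + a' x'`, with `a` a nonzero multiple of the
wanted coordinate. On additive maps the operator on the left kills `x ↦ x` and rescales `x ↦ x'`, so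
its values on `ℤ[ε²]` have no `x` component, and `a = 0`. -/

open Polynomial in
theorem exists_polynomial_eval_eq_sum_range (q : ℂ[X]) :
    ∃ Q : ℂ[X], ∀ n : ℕ, Q.eval (n : ℂ) = ∑ s ∈ Finset.range n, q.eval (s : ℂ) := by
  induction q using Polynomial.induction_on' with
  | add p q hp hq =>
    obtain ⟨P, hP⟩ := hp
    obtain ⟨Q, hQ⟩ := hq
    exact ⟨P + Q, fun n => by simp [hP, hQ, Finset.sum_add_distrib]⟩
  | monomial k a =>
    -- Faulhaber's formula, read as a polynomial in `n`.
    refine ⟨C a * ∑ i ∈ Finset.range (k + 1),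
      C ((_root_.bernoulli i * ((k + 1).choose i : ℚ) / (k + 1) : ℚ) : ℂ) * X ^ (k + 1 - i), fun n => ?_⟩
    have h := congrArg (fun r : ℚ => (r : ℂ)) (sum_range_pow n k)
    push_cast at h
    simp only [eval_monomial, ← Finset.mul_sum, h, eval_mul, eval_C, eval_finsetSum, eval_pow,
      eval_X]
    push_cast
    congr 1
    refine Finset.sum_congr rfl fun i _ => ?_
    ring

open Polynomial in
theorem polynomial_eq_of_eval_nat {p q : ℂ[X]} (h : ∀ n : ℕ, p.eval (n : ℂ) = q.eval (n : ℂ)) :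
    p = q := by
  refine Polynomial.eq_of_infinite_eval_eq p q
    ((Set.infinite_range_of_injective (Nat.cast_injective (R := ℂ))).mono ?_)
  rintro _ ⟨n, rfl⟩
  exact h n

/-! ### Matrix entries of the symmetric powers -/

theorem symMatrix_diagonal (l : ℕ) (a d : ℂ) (i k : Fin (l + 1)) :
    symMatrix l !![a, 0; 0, d] i k =
      if k = i then a ^ (l - (i : ℕ)) * d ^ (i : ℕ) else 0 := by
  have hi := i.2
  have hk := k.2
  have h : l - (k : ℕ) = l - (i : ℕ) ↔ k = i := by rw [Fin.ext_iff]; omega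
  simp only [symMatrix, Matrix.of_apply, Matrix.cons_val', Matrix.cons_val_zero,
    Matrix.cons_val_one, Matrix.cons_val_fin_one, map_zero, add_zero, zero_mul, zero_add, mul_pow,
    ← Polynomial.C_pow]
  rw [Polynomial.coeff_mul_C, Polynomial.coeff_C_mul, Polynomial.coeff_X_pow]
  simp only [h]
  split_ifs <;> simp

theorem symMatrix_weyl (l : ℕ) (i k : Fin (l + 1)) :
    symMatrix l !![0, 1; -1, 0] i k = if k = i.rev then (-1) ^ (i : ℕ) else 0 := by
  have hi := i.2
  have hk := k.2
  have h : l - (k : ℕ) = (i : ℕ) ↔ k = i.rev := by rw [Fin.ext_iff, Fin.val_rev]; omega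
  simp only [symMatrix, Matrix.of_apply, Matrix.cons_val', Matrix.cons_val_zero,
    Matrix.cons_val_one, Matrix.cons_val_fin_one, map_zero, add_zero, zero_mul, zero_add, mul_pow,
    map_one, one_pow, one_mul, ← Polynomial.C_pow]
  rw [Polynomial.coeff_C_mul, Polynomial.coeff_X_pow]
  simp only [h]
  split_ifs <;> simp

open Polynomial in
/-- The entries of `ρ_l(!![1, t * x; 0, 1])` as polynomials in `t`. -/
noncomputable def unipotentEntry (l : ℕ) (x : ℂ) (i k : Fin (l + 1)) : ℂ[X] :=
  monomial (l - (i : ℕ) - (l - (k : ℕ)))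
    (x ^ (l - (i : ℕ) - (l - (k : ℕ))) * ((l - (i : ℕ)).choose (l - (k : ℕ)) : ℂ))

theorem eval_unipotentEntry (l : ℕ) (t x : ℂ) (i k : Fin (l + 1)) :
    (unipotentEntry l x i k).eval t = symMatrix l !![1, t * x; 0, 1] i k := by
  simp only [symMatrix, Matrix.of_apply, Matrix.cons_val', Matrix.cons_val_zero,
    Matrix.cons_val_one, Matrix.cons_val_fin_one, map_zero, zero_mul, zero_add, one_mul,
    map_one, one_pow, mul_one]
  rw [Polynomial.coeff_X_add_C_pow, unipotentEntry, Polynomial.eval_monomial]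
  ring

theorem coeff_zero_unipotentEntry (l : ℕ) (x : ℂ) (i k : Fin (l + 1)) :
    (unipotentEntry l x i k).coeff 0 = if k = i then 1 else 0 := by
  have hi := i.2
  have hk := k.2
  rw [unipotentEntry, Polynomial.coeff_monomial]
  rcases lt_trichotomy k i with h | h | h
  -- Below the diagonal the truncated exponent is `0`, so it is the binomial coefficient that makes
  -- the entry vanish.
  · rw [if_neg h.ne, Nat.choose_eq_zero_of_lt (by rw [Fin.lt_def] at h; omega)]
    simp
  · subst h
    simp
  · rw [if_neg h.ne', if_neg (by rw [Fin.lt_def] at h; omega)]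

theorem coeff_one_unipotentEntry (l : ℕ) (x : ℂ) (i k : Fin (l + 1)) :
    (unipotentEntry l x i k).coeff 1 =
      x * if (k : ℕ) = i + 1 then ((l - (i : ℕ) : ℕ) : ℂ) else 0 := by
  have hi := i.2
  have hk := k.2
  rw [unipotentEntry, Polynomial.coeff_monomial]
  by_cases h : (k : ℕ) = i + 1
  · have h1 : l - (i : ℕ) - (l - (k : ℕ)) = 1 := by omega
    have h2 : l - (i : ℕ) = (l - (k : ℕ)) + 1 := by omega
    rw [if_pos h1, if_pos h, h1, h2, Nat.choose_succ_self_right, pow_one]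
  · rw [if_neg (by omega), if_neg h, mul_zero]

/-! ### Coordinates of the action on `V` -/

variable {F : Type} [Field F]

/-- The coordinates of `V` with respect to the basis `e_i ⊗ e'_j`, numbered from `0`. -/
noncomputable def coord {l₁ l₂ : ℕ} (i : Fin (l₁ + 1)) (j : Fin (l₂ + 1)) : V l₁ l₂ →ₗ[ℂ] ℂ :=
  ((Pi.basisFun ℂ (Fin (l₁ + 1))).tensorProduct (Pi.basisFun ℂ (Fin (l₂ + 1)))).coord (i, j)

theorem coord_tmul {l₁ l₂ : ℕ} (i : Fin (l₁ + 1)) (j : Fin (l₂ + 1)) (a : Fin (l₁ + 1) → ℂ)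
    (b : Fin (l₂ + 1) → ℂ) : coord i j (a ⊗ₜ[ℂ] b) = a i * b j := by
  simp [coord, mul_comm]

theorem coord_rhoSL (τ₁ τ₂ : F →+* ℝ) (l₁ l₂ : ℕ) (γ : SL(2, 𝓞 F)) (v : V l₁ l₂)
    (i : Fin (l₁ + 1)) (j : Fin (l₂ + 1)) :
    coord i j (rhoSL τ₁ τ₂ l₁ l₂ γ v) =
      ∑ k, ∑ m, symMatrix l₁ (γ.1.map (toComplex τ₁)) i k *
        symMatrix l₂ (γ.1.map (toComplex τ₂)) j m * coord k m v := by
  induction v using TensorProduct.induction_on with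
  | zero => simp
  | add v w hv hw => simp only [map_add, hv, hw, mul_add, Finset.sum_add_distrib]
  | tmul a b =>
    have h : rhoSL τ₁ τ₂ l₁ l₂ γ (a ⊗ₜ[ℂ] b) =
        (symMatrix l₁ (γ.1.map (toComplex τ₁))).mulVec a ⊗ₜ[ℂ]
          (symMatrix l₂ (γ.1.map (toComplex τ₂))).mulVec b := rfl
    simp only [h, coord_tmul, Matrix.mulVec, dotProduct, Finset.sum_mul_sum]
    refine Finset.sum_congr rfl fun k _ => Finset.sum_congr rfl fun m _ => ?_
    ring

theorem coeff_eq_coord {l₁ l₂ : ℕ} (v : V l₁ l₂) (i : Fin (l₁ + 1)) (j : Fin (l₂ + 1)) :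
    coeff v (i + 1) (j + 1) = coord i j v := by
  rw [coeff, dif_pos (by omega)]
  rfl

theorem map_upper (τ : F →+* ℝ) (u : (𝓞 F)ˣ) (v : 𝓞 F) :
    (upper u v).1.map (toComplex τ) =
      !![toComplex τ u, toComplex τ v; 0, (toComplex τ u)⁻¹] := by
  have h : toComplex τ ((u⁻¹ : (𝓞 F)ˣ) : 𝓞 F) = (toComplex τ u)⁻¹ :=
    eq_inv_of_mul_eq_one_left (by rw [← map_mul, Units.inv_mul, map_one])
  ext i j
  fin_cases i <;> fin_cases j <;> simp [upper, h]

section Actions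

variable (τ₁ τ₂ : F →+* ℝ) {l₁ l₂ : ℕ} (hl : l₁ ≡ l₂ [MOD 2])

theorem coord_rho_mu (ε : (𝓞 F)ˣ) (v : V l₁ l₂) (i : Fin (l₁ + 1)) (j : Fin (l₂ + 1)) :
    coord i j (rho τ₁ τ₂ hl (mu ε) v) =
      toComplex τ₁ ε ^ (l₁ - (i : ℕ)) * (toComplex τ₁ ε)⁻¹ ^ (i : ℕ) *
        (toComplex τ₂ ε ^ (l₂ - (j : ℕ)) * (toComplex τ₂ ε)⁻¹ ^ (j : ℕ)) * coord i j v := by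
  change coord i j (rhoSL τ₁ τ₂ l₁ l₂ (upper ε 0) v) = _
  rw [coord_rhoSL]
  simp only [map_upper, map_zero, symMatrix_diagonal]
  simp

theorem coord_rho_sigma (v : V l₁ l₂) (i : Fin (l₁ + 1)) (j : Fin (l₂ + 1)) :
    coord i j (rho τ₁ τ₂ hl (sigma F) v) =
      (-1) ^ (i : ℕ) * (-1) ^ (j : ℕ) * coord i.rev j.rev v := by
  have h : ∀ τ : F →+* ℝ, (!![0, 1; -1, 0] : Matrix (Fin 2) (Fin 2) (𝓞 F)).map (toComplex τ) =
      !![0, 1; -1, 0] := by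
    intro τ
    ext i j
    fin_cases i <;> fin_cases j <;> simp
  refine (coord_rhoSL τ₁ τ₂ l₁ l₂ ⟨!![0, 1; -1, 0], by simp [Matrix.det_fin_two]⟩ v i j).trans ?_
  simp only [h, symMatrix_weyl]
  simp

theorem coord_rho_unipotent (n : ℕ) (x : 𝓞 F) (v : V l₁ l₂) (i : Fin (l₁ + 1))
    (j : Fin (l₂ + 1)) :
    coord i j (rho τ₁ τ₂ hl (toPSL (upper 1 (n * x))) v) =
      (∑ k, ∑ m, unipotentEntry l₁ (toComplex τ₁ x) i k * unipotentEntry l₂ (toComplex τ₂ x) j m *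
        Polynomial.C (coord k m v)).eval (n : ℂ) := by
  change coord i j (rhoSL τ₁ τ₂ l₁ l₂ (upper 1 (n * x)) v) = _
  rw [coord_rhoSL]
  simp only [map_upper, Polynomial.eval_finsetSum, Polynomial.eval_mul, Polynomial.eval_C,
    eval_unipotentEntry, map_mul, map_natCast, Units.val_one, map_one, inv_one]

end Actions

end HilbertCocycle

namespace HilbertCocycle

/-! ### Norms and traces in the quadratic field -/

section QuadraticField

variable {F : Type} [Field F] [NumberField F]

/-- A quadratic field has exactly two complex embeddings, so two distinct real ones exhaust them. -/
theorem exists_ratAlgHom_pair (hF : Module.finrank ℚ F = 2) {τ₁ τ₂ : F →+* ℝ} (hτ : τ₁ ≠ τ₂) :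
    ∃ φ₁ φ₂ : F →ₐ[ℚ] ℂ, (∀ x, φ₁ x = τ₁ x) ∧ (∀ x, φ₂ x = τ₂ x) ∧
      (∀ g : (F →ₐ[ℚ] ℂ) → ℂ, ∏ φ, g φ = g φ₁ * g φ₂ ∧ ∑ φ, g φ = g φ₁ + g φ₂) := by
  classical
  let φ₁ : F →ₐ[ℚ] ℂ := RingHom.toRatAlgHom (Complex.ofRealHom.comp τ₁)
  let φ₂ : F →ₐ[ℚ] ℂ := RingHom.toRatAlgHom (Complex.ofRealHom.comp τ₂)
  have hne : φ₁ ≠ φ₂ := fun h => hτ <| RingHom.ext fun x =>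
    Complex.ofReal_injective (DFunLike.congr_fun h x)
  have huniv : ({φ₁, φ₂} : Finset (F →ₐ[ℚ] ℂ)) = Finset.univ := by
    refine Finset.eq_univ_of_card _ ?_
    rw [Finset.card_pair hne, AlgHom.card, hF]
  refine ⟨φ₁, φ₂, fun _ => rfl, fun _ => rfl, fun g => ?_⟩
  rw [← huniv, Finset.prod_pair hne, Finset.sum_pair hne]
  exact ⟨rfl, rfl⟩

theorem norm_eq_mul_of_finrank_two (hF : Module.finrank ℚ F = 2) {τ₁ τ₂ : F →+* ℝ}
    (hτ : τ₁ ≠ τ₂) (x : F) : ((Algebra.norm ℚ x : ℚ) : ℝ) = τ₁ x * τ₂ x := by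
  obtain ⟨φ₁, φ₂, h₁, h₂, hg⟩ := exists_ratAlgHom_pair hF hτ
  have h := Algebra.norm_eq_prod_embeddings ℚ ℂ x
  rw [(hg _).1, h₁, h₂, eq_ratCast] at h
  exact_mod_cast h

theorem trace_eq_add_of_finrank_two (hF : Module.finrank ℚ F = 2) {τ₁ τ₂ : F →+* ℝ}
    (hτ : τ₁ ≠ τ₂) (x : F) : ((Algebra.trace ℚ F x : ℚ) : ℝ) = τ₁ x + τ₂ x := by
  obtain ⟨φ₁, φ₂, h₁, h₂, hg⟩ := exists_ratAlgHom_pair hF hτ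
  have h := trace_eq_sum_embeddings ℂ (K := ℚ) (x := x)
  rw [(hg _).2, h₁, h₂, eq_ratCast] at h
  exact_mod_cast h

/-- This is the characteristic equation of an integer of norm `1`; `t` is its trace. -/
theorem exists_int_sq_add_one_eq (hF : Module.finrank ℚ F = 2) {τ₁ τ₂ : F →+* ℝ}
    (hτ : τ₁ ≠ τ₂) (x : 𝓞 F) (hx : τ₁ x * τ₂ x = 1) : ∃ t : ℤ, x ^ 2 + 1 = t * x := by
  refine ⟨Algebra.trace ℤ (𝓞 F) x, ?_⟩
  have ht : ((Algebra.trace ℤ (𝓞 F) x : ℤ) : ℝ) = τ₁ x + τ₂ x := by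
    rw [← trace_eq_add_of_finrank_two hF hτ, ← Algebra.coe_trace_int]
    simp
  apply NumberField.RingOfIntegers.ext
  apply τ₁.injective
  simp only [map_add, map_pow, map_mul, map_one, map_intCast, ht]
  linear_combination -hx

theorem norm_unit_eq_one_or (ε : (𝓞 F)ˣ) :
    Algebra.norm ℚ ((ε : 𝓞 F) : F) = 1 ∨ Algebra.norm ℚ ((ε : 𝓞 F) : F) = -1 := by
  rw [← Algebra.coe_norm_int]
  rcases Int.isUnit_iff.mp (ε.isUnit.map (Algebra.norm ℤ)) with h | h <;> simp [h]

end QuadraticField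

/-- An additive map `β` for which `η β(x) - β(η x)` is a combination `a x + a' x'` has `a = 0`. -/
theorem eq_zero_of_additive_of_twist {R : Type} [CommRing R] (φ₁ φ₂ : R →+* ℂ) (η : R) (t : ℤ)
    (ht : η ^ 2 + 1 = t * η) (hinv : φ₁ η * φ₂ η = 1) (hne : φ₁ η ≠ φ₂ η)
    (β : R →+ ℂ) (a a' : ℂ) (h : ∀ x, φ₁ η * β x - β (η * x) = a * φ₁ x + a' * φ₂ x) :
    a = 0 := by
  have h1 := h 1
  have h2 := h η
  have h3 : β (η * η) = t * β η - β 1 := by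
    have : η * η = t • η - 1 := by rw [zsmul_eq_mul]; linear_combination ht
    rw [this, map_sub, map_zsmul, zsmul_eq_mul]
  have h4 : φ₁ η ^ 2 + 1 = t * φ₁ η := by
    rw [← map_pow, ← map_one φ₁, ← map_add, ht, map_mul, map_intCast]
  rw [mul_one, map_one φ₁, map_one φ₂] at h1
  rw [h3] at h2
  -- Since `φ₁ η + φ₂ η = t`, subtracting the relation at `x = η` from `φ₂ η` times the one at `x =
  -- 1` eliminates `β 1`, `β η` and `a'`.
  have h5 : a * (φ₁ η - φ₂ η) = 0 := by
    have hφ : φ₁ η + φ₂ η = t := by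
      have h0 : φ₁ η ≠ 0 := left_ne_zero_of_mul_eq_one hinv
      apply mul_left_cancel₀ h0
      linear_combination h4 + hinv
    linear_combination φ₂ η * h1 - h2 + β η * hφ - β 1 * hinv
  exact (mul_eq_zero.mp h5).resolve_right (sub_ne_zero.mpr hne)

/-! ### Crossed maps on the unipotent subgroup -/

section Cocycle

variable {F : Type} [Field F] (τ₁ τ₂ : F →+* ℝ) {l₁ l₂ : ℕ} (hl : l₁ ≡ l₂ [MOD 2])
  (b : PSL(2, 𝓞 F) → V l₁ l₂)

/-- Left multiplication by `P` is compatible with `b` as for a crossed homomorphism. -/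
def IsCrossedOn : Prop := ∀ p ∈ P F, ∀ γ, b (p * γ) = rho τ₁ τ₂ hl p (b γ) + b p

theorem toPSL_upper_mem (u : (𝓞 F)ˣ) (v : 𝓞 F) : toPSL (upper u v) ∈ P F := ⟨u, v, rfl⟩

variable {τ₁ τ₂ hl b}

theorem IsCrossedOn.map_one (hb : IsCrossedOn τ₁ τ₂ hl b) : b 1 = 0 := by
  have h := hb 1 (P F).one_mem 1
  rw [mul_one, _root_.map_one] at h
  simpa using h

theorem IsCrossedOn.unipotent_add (hb : IsCrossedOn τ₁ τ₂ hl b) (x y : 𝓞 F) :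
    b (toPSL (upper 1 (x + y))) =
      rho τ₁ τ₂ hl (toPSL (upper 1 x)) (b (toPSL (upper 1 y))) + b (toPSL (upper 1 x)) := by
  rw [← hb _ (toPSL_upper_mem 1 x), ← map_mul, upper_mul]
  simp [add_comm]

/-- Iterating the cocycle rule writes `b(u(nx))` as the sum of `u(sx) b(u(x))` over `s < n`; the
summands have coordinates polynomial in `s`. -/
theorem IsCrossedOn.exists_polynomial (hb : IsCrossedOn τ₁ τ₂ hl b) (x : 𝓞 F)
    (i : Fin (l₁ + 1)) (j : Fin (l₂ + 1)) :
    ∃ Q : Polynomial ℂ, ∀ n : ℕ, Q.eval (n : ℂ) = coord i j (b (toPSL (upper 1 (n * x)))) := by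
  obtain ⟨Q, hQ⟩ := exists_polynomial_eval_eq_sum_range
    (∑ k, ∑ m, unipotentEntry l₁ (toComplex τ₁ x) i k * unipotentEntry l₂ (toComplex τ₂ x) j m *
        Polynomial.C (coord k m (b (toPSL (upper 1 x)))))
  refine ⟨Q, fun n => ?_⟩
  rw [hQ]
  simp only [← coord_rho_unipotent τ₁ τ₂ hl]
  induction n with
  | zero => rw [Finset.sum_range_zero, Nat.cast_zero, zero_mul, upper_one, _root_.map_one,
      hb.map_one, map_zero]
  | succ n ih =>
    rw [Finset.sum_range_succ, ih, Nat.cast_succ, add_mul, one_mul, hb.unipotent_add, map_add,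
      add_comm]

/-- The polynomial in `n` that interpolates a coordinate of `b(!![1, n * x; 0, 1])`. -/
noncomputable def IsCrossedOn.poly (hb : IsCrossedOn τ₁ τ₂ hl b) (x : 𝓞 F)
    (i : Fin (l₁ + 1)) (j : Fin (l₂ + 1)) : Polynomial ℂ :=
  (hb.exists_polynomial x i j).choose

theorem IsCrossedOn.eval_poly (hb : IsCrossedOn τ₁ τ₂ hl b) (x : 𝓞 F)
    (i : Fin (l₁ + 1)) (j : Fin (l₂ + 1)) (n : ℕ) :
    (hb.poly x i j).eval (n : ℂ) = coord i j (b (toPSL (upper 1 (n * x)))) :=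
  (hb.exists_polynomial x i j).choose_spec n

theorem IsCrossedOn.coeff_zero_poly (hb : IsCrossedOn τ₁ τ₂ hl b) (x : 𝓞 F)
    (i : Fin (l₁ + 1)) (j : Fin (l₂ + 1)) : (hb.poly x i j).coeff 0 = 0 := by
  have h := hb.eval_poly x i j 0
  rw [Nat.cast_zero, Nat.cast_zero, zero_mul, upper_one, _root_.map_one, hb.map_one, map_zero] at h
  rwa [Polynomial.coeff_zero_eq_eval_zero]

theorem coeff_one_unipotentEntry_mul (x y : ℂ) (i k : Fin (l₁ + 1)) (j m : Fin (l₂ + 1)) :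
    (unipotentEntry l₁ x i k * unipotentEntry l₂ y j m).coeff 1 =
      x * (if (k : ℕ) = i + 1 then if m = j then ((l₁ - (i : ℕ) : ℕ) : ℂ) else 0 else 0) +
      y * (if (m : ℕ) = j + 1 then if k = i then ((l₂ - (j : ℕ) : ℕ) : ℂ) else 0 else 0) := by
  rw [Polynomial.mul_coeff_one, coeff_zero_unipotentEntry, coeff_zero_unipotentEntry,
    coeff_one_unipotentEntry, coeff_one_unipotentEntry]
  split_ifs <;> simp [add_comm]

theorem coeff_zero_unipotentEntry_mul (x y : ℂ) (i k : Fin (l₁ + 1)) (j m : Fin (l₂ + 1)) :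
    (unipotentEntry l₁ x i k * unipotentEntry l₂ y j m).coeff 0 =
      if k = i then if m = j then 1 else 0 else 0 := by
  rw [Polynomial.mul_coeff_zero, coeff_zero_unipotentEntry, coeff_zero_unipotentEntry]
  split_ifs <;> simp

/-- The linear terms of the coordinates of `b` on the unipotent subgroup. -/
noncomputable def IsCrossedOn.linearTerm (hb : IsCrossedOn τ₁ τ₂ hl b) (i : Fin (l₁ + 1))
    (j : Fin (l₂ + 1)) : 𝓞 F →+ ℂ :=
  AddMonoidHom.mk' (fun x => (hb.poly x i j).coeff 1) fun x y => by
    have h : hb.poly (x + y) i j = (∑ k, ∑ m, unipotentEntry l₁ (toComplex τ₁ x) i k *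
        unipotentEntry l₂ (toComplex τ₂ x) j m * hb.poly y k m) + hb.poly x i j := by
      refine polynomial_eq_of_eval_nat fun n => ?_
      rw [Polynomial.eval_add, hb.eval_poly, hb.eval_poly, mul_add, hb.unipotent_add, map_add,
        coord_rho_unipotent]
      simp only [Polynomial.eval_finsetSum, Polynomial.eval_mul, Polynomial.eval_C, hb.eval_poly]
    -- The interpolating polynomials have no constant term and the matrix is the identity at `n =
    -- 0`, so no cross terms reach degree one.
    rw [h, Polynomial.coeff_add, add_comm]
    simp only [Polynomial.finsetSum_coeff, Polynomial.mul_coeff_one _ (hb.poly _ _ _),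
      hb.coeff_zero_poly, mul_zero, add_zero, coeff_zero_unipotentEntry_mul, ite_mul, one_mul,
      zero_mul]
    simp

theorem IsCrossedOn.mu_unipotent (hb : IsCrossedOn τ₁ τ₂ hl b) (ε : (𝓞 F)ˣ) (x : 𝓞 F) :
    rho τ₁ τ₂ hl (mu ε) (b (toPSL (upper 1 x))) + b (mu ε) =
      rho τ₁ τ₂ hl (toPSL (upper 1 ((ε : 𝓞 F) ^ 2 * x))) (b (mu ε)) +
        b (toPSL (upper 1 ((ε : 𝓞 F) ^ 2 * x))) := by
  have h : mu ε * toPSL (upper 1 x) = toPSL (upper 1 ((ε : 𝓞 F) ^ 2 * x)) * mu ε := by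
    rw [mu, ← map_mul, ← map_mul, upper_mul, upper_mul]
    congr 2
    · simp
    · have := ε.mul_inv
      simp only [Units.val_one, inv_one, mul_zero, zero_add, mul_one, add_zero]
      linear_combination (-(ε : 𝓞 F) * x) * this
  rw [← hb (mu ε) (toPSL_upper_mem ε 0), ← hb _ (toPSL_upper_mem 1 _), ← h]

/-- Compares the coefficients of `n` in `mu_unipotent` at `n * x`. To first order a unipotent raises
a single index by one, in either factor. The second contribution is kept as a sum, which is empty of
nonzero terms when `j = l₂`. -/
theorem IsCrossedOn.linearTerm_twist (hb : IsCrossedOn τ₁ τ₂ hl b) (ε : (𝓞 F)ˣ) (x : 𝓞 F)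
    (i k : Fin (l₁ + 1)) (j : Fin (l₂ + 1)) (hk : (k : ℕ) = i + 1) :
    toComplex τ₁ ε ^ (l₁ - (i : ℕ)) * (toComplex τ₁ ε)⁻¹ ^ (i : ℕ) *
        (toComplex τ₂ ε ^ (l₂ - (j : ℕ)) * (toComplex τ₂ ε)⁻¹ ^ (j : ℕ)) * hb.linearTerm i j x -
        hb.linearTerm i j (ε ^ 2 * x) =
      toComplex τ₁ (ε ^ 2 * x) * (((l₁ - (i : ℕ) : ℕ) : ℂ) * coord k j (b (mu ε))) +
      toComplex τ₂ (ε ^ 2 * x) *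
        ∑ m : Fin (l₂ + 1), (if (m : ℕ) = j + 1 then ((l₂ - (j : ℕ) : ℕ) : ℂ) else 0) *
          coord i m (b (mu ε)) := by
  set χ := toComplex τ₁ ε ^ (l₁ - (i : ℕ)) * (toComplex τ₁ ε)⁻¹ ^ (i : ℕ) *
        (toComplex τ₂ ε ^ (l₂ - (j : ℕ)) * (toComplex τ₂ ε)⁻¹ ^ (j : ℕ)) with hχ
  have h : Polynomial.C χ * hb.poly x i j + Polynomial.C (coord i j (b (mu ε))) =
      (∑ k, ∑ m, unipotentEntry l₁ (toComplex τ₁ (ε ^ 2 * x)) i k *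
        unipotentEntry l₂ (toComplex τ₂ (ε ^ 2 * x)) j m * Polynomial.C (coord k m (b (mu ε)))) +
        hb.poly (ε ^ 2 * x) i j := by
    refine polynomial_eq_of_eval_nat fun n => ?_
    have h := congrArg (coord i j) (hb.mu_unipotent ε (n * x))
    rw [map_add, map_add, mul_left_comm, coord_rho_unipotent, coord_rho_mu, ← hb.eval_poly,
      ← hb.eval_poly, ← hχ] at h
    simpa only [Polynomial.eval_add, Polynomial.eval_mul, Polynomial.eval_C] using h
  have h1 := congrArg (fun p => Polynomial.coeff p 1) h
  simp only [Polynomial.coeff_add, Polynomial.coeff_C_mul, Polynomial.coeff_C, one_ne_zero,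
    if_false, add_zero] at h1
  change χ * (hb.poly x i j).coeff 1 - (hb.poly (ε ^ 2 * x) i j).coeff 1 = _
  have hk' : ∀ k' : Fin (l₁ + 1), ((k' : ℕ) = i + 1) = (k' = k) := fun k' => by
    rw [← hk, Fin.ext_iff]
  rw [h1, add_sub_cancel_right]
  simp only [Polynomial.finsetSum_coeff, Polynomial.coeff_mul_C, coeff_one_unipotentEntry_mul]
  simp only [add_mul, Finset.sum_add_distrib, mul_assoc, ← Finset.mul_sum, ite_mul, zero_mul, hk']
  congr 1
  · simp
  · rw [Finset.sum_comm]
    simp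

end Cocycle

end HilbertCocycle

namespace HilbertCocycle

/-! ### Vanishing of the weight-zero coefficients -/

theorem weight_eq {K : Type} [Field K] {a a' s : K} (h : a * a' = s) (hs : s = 1 ∨ s = -1)
    {l j : ℕ} (hsl : s ^ l = 1) (hj : j ≤ l) (m i : ℕ) :
    a ^ m * a⁻¹ ^ i * (a' ^ (l - j) * a'⁻¹ ^ j) = a ^ (m + j) * a⁻¹ ^ (i + (l - j)) := by
  have hss : s * s = 1 := by rcases hs with rfl | rfl <;> ring
  have haa : a ≠ 0 := by
    rintro rfl
    rw [zero_mul] at h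
    simp [← h] at hss
  have h1 : a' = s * a⁻¹ := by rw [← h]; field_simp
  have h2 : a'⁻¹ = s * a := by
    rw [h1, mul_inv, inv_inv, inv_eq_of_mul_eq_one_right hss]
  have h3 : s ^ (l - j) * s ^ j = 1 := by rw [← pow_add, Nat.sub_add_cancel hj, hsl]
  rw [h2, h1, mul_pow, mul_pow, pow_add, pow_add]
  linear_combination (a ^ m * a⁻¹ ^ i * a⁻¹ ^ (l - j) * a ^ j) * h3

theorem mu_mul_sigma_mul_mu {F : Type} [Field F] (ε : (𝓞 F)ˣ) :
    mu ε * (sigma F * mu ε) = sigma F := by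
  obtain ⟨S, hS, hS'⟩ : ∃ S : SL(2, 𝓞 F), sigma F = toPSL S ∧ S.1 = !![0, 1; -1, 0] :=
    ⟨_, rfl, rfl⟩
  rw [mu, hS, ← map_mul, ← map_mul]
  refine congrArg toPSL (Subtype.ext ?_)
  rw [Matrix.SpecialLinearGroup.coe_mul, Matrix.SpecialLinearGroup.coe_mul, hS']
  simp [upper]

variable {F : Type} [Field F] [NumberField F] {τ₁ τ₂ : F →+* ℝ} {l₁ l₂ : ℕ}
  {hl : l₁ ≡ l₂ [MOD 2]} {b : PSL(2, 𝓞 F) → V l₁ l₂}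

theorem toComplex_mul_toComplex (hF : Module.finrank ℚ F = 2) (hτ : τ₁ ≠ τ₂) {ε : (𝓞 F)ˣ}
    (hl : l₁ ≡ l₂ [MOD 2]) (hN : Algebra.norm ℚ ((ε : 𝓞 F) : F) = -1 → Even l₁) :
    (toComplex τ₁ ε * toComplex τ₂ ε = 1 ∨ toComplex τ₁ ε * toComplex τ₂ ε = -1) ∧
      (toComplex τ₁ ε * toComplex τ₂ ε) ^ l₂ = 1 := by
  have h := congrArg Complex.ofReal (norm_eq_mul_of_finrank_two hF hτ ((ε : 𝓞 F) : F))
  have h' : toComplex τ₁ ε * toComplex τ₂ ε =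
      ((Algebra.norm ℚ ((ε : 𝓞 F) : F) : ℝ) : ℂ) := by
    rw [h, Complex.ofReal_mul]
    rfl
  rw [h']
  rcases norm_unit_eq_one_or ε with h1 | h1
  · simp [h1]
  · have : Even l₂ := by
      have h2 := hN h1
      unfold Nat.ModEq at hl
      rw [Nat.even_iff] at h2 ⊢
      omega
    simp [h1, this.neg_one_pow]

theorem IsCrossedOn.coord_mu_eq_zero (hF : Module.finrank ℚ F = 2) (hτ : τ₁ ≠ τ₂)
    {ε : (𝓞 F)ˣ} (hε : 1 < τ₁ (ε : 𝓞 F)) (hle : l₂ ≤ l₁)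
    (hN : Algebra.norm ℚ ((ε : 𝓞 F) : F) = -1 → Even l₁) (hb : IsCrossedOn τ₁ τ₂ hl b)
    (k : Fin (l₁ + 1)) (j : Fin (l₂ + 1)) (hkj : (j : ℕ) + (l₁ - l₂) / 2 = k) (hk : (k : ℕ) ≠ 0) :
    coord k j (b (mu ε)) = 0 := by
  obtain ⟨hs, hsl⟩ := toComplex_mul_toComplex (ε := ε) hF hτ hl hN
  have hk2 := k.2
  have hj2 := j.2
  have hl' := hl
  unfold Nat.ModEq at hl'
  -- One step before `k`: there `μ` has weight `ε²`, and the linear term of the unipotent action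
  -- sees the coordinate at `k`.
  let i : Fin (l₁ + 1) := ⟨k - 1, by omega⟩
  have hik : (k : ℕ) = i + 1 := by simp only [i]; omega
  have ha0 : toComplex τ₁ (ε : 𝓞 F) ≠ 0 := (ε.isUnit.map (toComplex τ₁)).ne_zero
  have hχ : toComplex τ₁ ε ^ (l₁ - (i : ℕ)) * (toComplex τ₁ ε)⁻¹ ^ (i : ℕ) *
        (toComplex τ₂ ε ^ (l₂ - (j : ℕ)) * (toComplex τ₂ ε)⁻¹ ^ (j : ℕ)) =
      toComplex τ₁ (ε ^ 2) := by
    rw [weight_eq rfl hs hsl (by omega)]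
    have he : l₁ - (i : ℕ) + j = 2 + (i + (l₂ - (j : ℕ))) := by omega
    rw [he, pow_add, mul_assoc, ← mul_pow, mul_inv_cancel₀ ha0, one_pow, mul_one, map_pow]
  have hinv : toComplex τ₁ ((ε : 𝓞 F) ^ 2) * toComplex τ₂ ((ε : 𝓞 F) ^ 2) = 1 := by
    rw [map_pow, map_pow, ← mul_pow]
    rcases hs with h | h <;> rw [h] <;> norm_num
  have hinv' : τ₁ ((ε : 𝓞 F) ^ 2 : 𝓞 F) * τ₂ ((ε : 𝓞 F) ^ 2 : 𝓞 F) = 1 := by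
    apply Complex.ofReal_injective
    rw [Complex.ofReal_mul]
    exact hinv
  have hgt : 1 < τ₁ ((ε : 𝓞 F) ^ 2 : 𝓞 F) :=
    (one_lt_pow₀ hε two_ne_zero).trans_eq (by simp)
  -- The two values have product `1` and the first exceeds `1`.
  have hne : toComplex τ₁ ((ε : 𝓞 F) ^ 2) ≠ toComplex τ₂ ((ε : 𝓞 F) ^ 2) := by
    intro h
    have h' : τ₁ ((ε : 𝓞 F) ^ 2 : 𝓞 F) = τ₂ ((ε : 𝓞 F) ^ 2 : 𝓞 F) := Complex.ofReal_injective h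
    rw [← h'] at hinv'
    nlinarith
  obtain ⟨t, ht⟩ := exists_int_sq_add_one_eq hF hτ _ hinv'
  have hzero := eq_zero_of_additive_of_twist (toComplex τ₁) (toComplex τ₂) ((ε : 𝓞 F) ^ 2) t ht
    hinv hne (hb.linearTerm i j) _ _ fun x => by
      rw [← hχ, hb.linearTerm_twist ε x i k j hik, map_mul, map_mul, mul_right_comm,
        mul_right_comm (toComplex τ₂ _)]
  rw [mul_eq_zero, mul_eq_zero, Nat.cast_eq_zero] at hzero
  rcases hzero with h | h | h
  · exact absurd h (by rw [map_pow]; exact pow_ne_zero 2 ha0)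
  · omega
  · exact h

theorem IsCrossedOn.coord_coboundary_eq_zero (hF : Module.finrank ℚ F = 2) (hτ : τ₁ ≠ τ₂)
    {ε : (𝓞 F)ˣ} (hε : 1 < τ₁ (ε : 𝓞 F)) (hle : l₂ ≤ l₁)
    (hN : Algebra.norm ℚ ((ε : 𝓞 F) : F) = -1 → Even l₁) (hb : IsCrossedOn τ₁ τ₂ hl b)
    (i : Fin (l₁ + 1)) (j : Fin (l₂ + 1)) (hij : (j : ℕ) + (l₁ - l₂) / 2 = i)
    (hadm : l₁ = l₂ → (i : ℕ) ≠ 0 ∧ (i : ℕ) ≠ l₁) :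
    coord i j (rho τ₁ τ₂ hl (sigma F) (b (mu ε)) + b (sigma F) - b (sigma F * mu ε)) = 0 := by
  obtain ⟨hs, hsl⟩ := toComplex_mul_toComplex (ε := ε) hF hτ hl hN
  have hi2 := i.2
  have hj2 := j.2
  have hl' := hl
  unfold Nat.ModEq at hl'
  have ha0 : toComplex τ₁ (ε : 𝓞 F) ≠ 0 := (ε.isUnit.map (toComplex τ₁)).ne_zero
  have h := congrArg (coord i j) (hb (mu ε) (toPSL_upper_mem ε 0) (sigma F * mu ε))
  have hir : (i.rev : ℕ) = l₁ - i := by rw [Fin.val_rev]; omega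
  have hjr : (j.rev : ℕ) = l₂ - j := by rw [Fin.val_rev]; omega
  -- The two exponents of `ε` cancel: `μ` acts trivially on this coordinate.
  have he : l₁ - (i : ℕ) + j = i + (l₂ - (j : ℕ)) := by omega
  rw [mu_mul_sigma_mul_mu, map_add, coord_rho_mu, weight_eq rfl hs hsl (by omega), he, ← mul_pow,
    mul_inv_cancel₀ ha0, one_pow, one_mul,
    hb.coord_mu_eq_zero hF hτ hε hle hN i j hij (by omega), add_zero] at h
  -- Reversal preserves the weight-zero pairs, so the vanishing applies to `(i.rev, j.rev)` as long
  -- as `i ≠ l₁`, which holds automatically if `l₁ ≠ l₂`.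
  rw [map_sub, map_add, h, add_sub_cancel_right, coord_rho_sigma,
    hb.coord_mu_eq_zero hF hτ hε hle hN i.rev j.rev (by omega) (by omega), mul_zero]

theorem IsCrossedOn.coeff_coboundary_eq_zero (hF : Module.finrank ℚ F = 2) (hτ : τ₁ ≠ τ₂)
    {ε : (𝓞 F)ˣ} (hε : 1 < τ₁ (ε : 𝓞 F)) (hle : l₂ ≤ l₁)
    (hN : Algebra.norm ℚ ((ε : 𝓞 F) : F) = -1 → Even l₁) (hb : IsCrossedOn τ₁ τ₂ hl b)
    (i : ℕ) (h₁ : (l₁ - l₂) / 2 + 1 ≤ i) (h₂ : i ≤ (l₁ + l₂) / 2 + 1)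
    (hadm : l₁ = l₂ → i ≠ 1 ∧ i ≠ l₁ + 1) :
    coeff (rho τ₁ τ₂ hl (sigma F) (b (mu ε)) + b (sigma F) - b (sigma F * mu ε))
      i (i - (l₁ - l₂) / 2) = 0 := by
  have hl' := hl
  unfold Nat.ModEq at hl'
  -- This `j` is the second index counted from `0`; `coeff` counts from `1`.
  obtain ⟨j, rfl⟩ := Nat.exists_eq_add_of_le h₁
  have h := hb.coord_coboundary_eq_zero hF hτ hε hle hN
    ⟨j + (l₁ - l₂) / 2, by omega⟩ ⟨j, by omega⟩ rfl (fun h => by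
      have := hadm h
      simp only
      omega)
  rw [← coeff_eq_coord] at h
  convert h using 2
  · simp only; omega
  · simp only; omega

theorem coeff_add {l₁ l₂ : ℕ} (v w : V l₁ l₂) (i j : ℕ) :
    coeff (v + w) i j = coeff v i j + coeff w i j := by
  unfold coeff
  split_ifs <;> simp

end HilbertCocycle

theorem lemma4p2 (F : Type) [Field F] [NumberField F] (hF : Module.finrank ℚ F = 2)
    (τ₁ τ₂ : F →+* ℝ) (hτ : τ₁ ≠ τ₂)
    (ε : (𝓞 F)ˣ) (hε : HilbertCocycle.IsFundamentalUnit τ₁ ε)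
    (l₁ l₂ : ℕ) (hle : l₂ ≤ l₁) (hl : l₁ ≡ l₂ [MOD 2])
    (hN : Algebra.norm ℚ ((ε : 𝓞 F) : F) = -1 → Even l₁) :
    (∀ f ∈ HilbertCocycle.parabolicCocycles τ₁ τ₂ hl,
      (∃ i : ℕ, (l₁ - l₂) / 2 + 1 ≤ i ∧ i ≤ (l₁ + l₂) / 2 + 1 ∧
        (l₁ = l₂ → i ≠ 1 ∧ i ≠ l₁ + 1) ∧
        HilbertCocycle.coeff (f (HilbertCocycle.sigma F, HilbertCocycle.mu ε))
          i (i - (l₁ - l₂) / 2) ≠ 0) →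
      groupCohomology.H2π (HilbertCocycle.VRep τ₁ τ₂ hl) f ≠ 0) ∧
    (∀ f ∈ HilbertCocycle.parabolicCocycles τ₁ τ₂ hl,
      ∀ g : PSL(2, 𝓞 F) × PSL(2, 𝓞 F) → HilbertCocycle.V l₁ l₂,
      HilbertCocycle.IsParabolicCoboundary τ₁ τ₂ hl g →
      ∀ i : ℕ, (l₁ - l₂) / 2 + 1 ≤ i → i ≤ (l₁ + l₂) / 2 + 1 →
        (l₁ = l₂ → i ≠ 1 ∧ i ≠ l₁ + 1) →
        HilbertCocycle.coeff (f (HilbertCocycle.sigma F, HilbertCocycle.mu ε) +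
            g (HilbertCocycle.sigma F, HilbertCocycle.mu ε)) i (i - (l₁ - l₂) / 2) =
          HilbertCocycle.coeff (f (HilbertCocycle.sigma F, HilbertCocycle.mu ε))
            i (i - (l₁ - l₂) / 2)) := by
  refine ⟨?_, ?_⟩
  · rintro f ⟨hf₁, hfP⟩ ⟨i, h₁, h₂, hadm, hi⟩ hzero
    obtain ⟨b, hb⟩ := (groupCohomology.H2π_eq_zero_iff f).mp hzero
    have hfb : ∀ γ₁ γ₂, f (γ₁, γ₂) =
        HilbertCocycle.rho τ₁ τ₂ hl γ₁ (b γ₂) - b (γ₁ * γ₂) + b γ₁ :=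
      fun γ₁ γ₂ => (congrFun hb (γ₁, γ₂)).symm
    have hcross : HilbertCocycle.IsCrossedOn τ₁ τ₂ hl b := by
      intro p hp γ
      -- With first argument `1`, parabolicity and normalization give `f(p, γ) = 0`, which is the
      -- crossed rule for `b`.
      have h := hfP p hp 1 γ
      rw [mul_one, (hf₁ γ).1, map_zero, hfb] at h
      rw [← sub_eq_zero, ← neg_eq_zero, ← h]
      abel
    refine hi ?_
    rw [hfb, sub_add_eq_add_sub]
    exact hcross.coeff_coboundary_eq_zero hF hτ hε.1 hle hN i h₁ h₂ hadm
  · rintro f - g ⟨b, hg, -, hb⟩ i h₁ h₂ hadm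
    have hcross : HilbertCocycle.IsCrossedOn τ₁ τ₂ hl b := hb
    rw [HilbertCocycle.coeff_add, hg,
      hcross.coeff_coboundary_eq_zero hF hτ hε.1 hle hN i h₁ h₂ hadm, add_zero]
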